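/- Let $N=(N_1,\dots,N_p)$ be a $p$-variate point process on $[0,\infty)$, defined on a probability space $(\Omega,\mathcal A,P)$: each $N_j$ is the counting measure of a random locally finite set of event times, and almost surely no two components have a common event time. For $S\subseteq[p]$ let $\mathcal F_t^S=\sigma(N_i([0,s]) : i\in S,\ s\le t)$ and $\mathcal H_t=\mathcal F_t^{[p]}$. Suppose that $N$ is a temporal point process graphical model, that is, for every $j\in[p]$ the $\mathcal H_t$-intensity of $N_j$ (the nonnegative predictable process $\lambda_j$, locally integrable in time, with $E\int C\,dN_j=E\int_0^\infty C(t)\lambda_j(t)\,dt$ for all nonnegative $\mathcal H_t$-predictable $C$) is $$\lambda_j(t)=h_j\Big(\mu_j+\sum_{k=1}^p\int_{[0,t)}\beta_{j,k}\,\kappa_{j,k}(t-s)\,dN_k(s)\Big),$$ with continuous link functions $h_j:\mathbb R\to[0,\infty)$, reals $\mu_j$, a transfer matrix $B=(\beta_{j,k})\in\mathbb R^{p\times p}$ and measurable, locally bounded kernels $\kappa_{j,k}:[0,\infty)\to\mathbb R$. For pairwise disjoint $A,B,C\subseteq[p]$ and a set of times $\mathcal T\subseteq[0,\infty)$, $N_A$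 is called locally independent of $N_B$ given $N_C$ over $\mathcal T$ if for all $t\in\mathcal T$ and $k\in A$, almost surely $$E[\lambda_k(t)\mid\mathcal F_t^{A\cup B\cup C}]=E[\lambda_k(t)\mid\mathcal F_t^{A\cup C}].$$ Fix $\mathcal T$ (for instance $[0,T]$ or $[0,\infty)$) and assume that $E\lambda_j(t)<\infty$ for all $j\in[p]$ and $t\in\mathcal T$ (which holds if the $h_j$ are bounded) and that the model is non-degenerate in the following sense: for every $j$ the background intensity $h_j(\mu_j)$ is positive and $h_j(x)\ne h_j(\mu_j)$ for all $x\neq\mu_j$ (both hold if the nonnegative function $h_j$ is strictly increasing); and for all $i\ne j$ there is $t\in\mathcal T$ such that $\kappa_{i,j}$ is not almost everywhere zero on $[0,t]$. Then, for all disjoint $A,B\subseteq[p]$, $N_A$ is locally independent of $N_B$ given $N_{(A\cup B)^c}$ over $\mathcal T$ if and only if $\beta_{i,j}=0$ for all $i\in A$ and $j\in B$. In particular, the local-independence graph, the directed graph on $[p]$ with an edge $j\to i$ ($j\ne i$) if and only if $N_i$ is not locally independent of $N_j$ given the remaining components over $\mathcal T$, has exactly the edges $j\to i$ with $j\neq i$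 and $\beta_{i,j}\neq0$. -/

import Mathlib

open MeasureTheory
open scoped NNReal ENNReal

noncomputable section

namespace TPP

/-- Lebesgue measure on the time axis `[0, ∞)`. -/
def timeMeasure : Measure ℝ≥0 :=
  Measure.comap (fun t : ℝ≥0 => (t : ℝ)) volume

/-- A `p`-variate point process on `[0, ∞)`: for every component `j` a random locally finite set
of (distinct) event times whose counts are random variables. -/
structure PointProcess (p : ℕ) (Ω : Type*) [MeasurableSpace Ω] where
  /-- the event times of the components -/
  times : Fin p → Ω → Set ℝ≥0
  finite_times : ∀ j ω t, (times j ω ∩ Set.Iic t).Finite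
  measurable_ncard : ∀ j t, Measurable fun ω => (times j ω ∩ Set.Iic t).ncard

namespace PointProcess

variable {p : ℕ} {Ω : Type*} [m : MeasurableSpace Ω]

/-- `N_j([0, t])`, the number of events of component `j` up to time `t`. -/
def count (N : PointProcess p Ω) (j : Fin p) (t : ℝ≥0) (ω : Ω) : ℕ :=
  (N.times j ω ∩ Set.Iic t).ncard

/-- The counting measure `dN_j`, which has unit mass at every event time of component `j`. -/
def eventMeasure (N : PointProcess p Ω) (j : Fin p) (ω : Ω) : Measure ℝ≥0 :=
  Measure.count.restrict (N.times j ω)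

/-- The history up to time `t` of the components in `S`: the σ-field generated by
`N_j([0, s])`, `j ∈ S`, `s ≤ t`. -/
@[reducible]
def history (N : PointProcess p Ω) (S : Set (Fin p)) (t : ℝ≥0) : MeasurableSpace Ω :=
  ⨆ j ∈ S, ⨆ s ∈ Set.Iic t, MeasurableSpace.comap (N.count j s) ⊤

theorem history_le (N : PointProcess p Ω) (S : Set (Fin p)) (t : ℝ≥0) : N.history S t ≤ m :=
  iSup₂_le fun j _ => iSup₂_le fun s _ => (N.measurable_ncard j s).comap_le

theorem history_mono (N : PointProcess p Ω) (S : Set (Fin p)) : Monotone (N.history S) :=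
  fun _ _ hst => iSup₂_mono fun _ _ =>
    iSup₂_le fun r hr => le_iSup₂_of_le r (le_trans hr hst) le_rfl

/-- The filtration generated by all the components. -/
def filtration (N : PointProcess p Ω) : Filtration ℝ≥0 m where
  seq := N.history Set.univ
  mono' := N.history_mono Set.univ
  le' := N.history_le Set.univ

/-- Almost surely, no two components have an event at the same time. -/
def NoCommonEvents (N : PointProcess p Ω) (P : Measure Ω) : Prop :=
  ∀ᵐ ω ∂P, ∀ j k, j ≠ k → Disjoint (N.times j ω) (N.times k ω)

/-- `lam` is the (stochastic) intensity of component `j` with respect to the filtration generated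
by the whole process, `lam t dt = P(dN_j(t) = 1 | history before t)`: it is nonnegative,
predictable and locally integrable, and `E ∫ C dN_j = E ∫ C lam dt` for every nonnegative
predictable process `C`. -/
structure IsIntensity (N : PointProcess p Ω) (P : Measure Ω) (j : Fin p)
    (lam : ℝ≥0 → Ω → ℝ) : Prop where
  nonneg : ∀ t ω, 0 ≤ lam t ω
  predictable : IsStronglyPredictable N.filtration lam
  locallyIntegrable : ∀ᵐ ω ∂P, ∀ t : ℝ≥0,
    ∫⁻ s in Set.Iic t, ENNReal.ofReal (lam s ω) ∂timeMeasure < ∞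
  lintegral_eq : ∀ C : ℝ≥0 × Ω → ℝ≥0∞, Measurable[N.filtration.predictable] C →
    ∫⁻ ω, ∫⁻ s, C (s, ω) ∂(N.eventMeasure j ω) ∂P
      = ∫⁻ ω, ∫⁻ s, C (s, ω) * ENNReal.ofReal (lam s ω) ∂timeMeasure ∂P

/-- For a process with intensity processes `lam`, the subprocess `N_T` (the target) is locally
independent of `N_S` (the source) given `N_C` over the set of times `𝒯`:
`E[lam_k(t) | F_t^{S ∪ T ∪ C}] = E[lam_k(t) | F_t^{T ∪ C}]` for all `t ∈ 𝒯` and `k ∈ T`. -/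
def LocallyIndependent (N : PointProcess p Ω) (P : Measure Ω) (lam : Fin p → ℝ≥0 → Ω → ℝ)
    (𝒯 : Set ℝ≥0) (T S C : Set (Fin p)) : Prop :=
  ∀ t ∈ 𝒯, ∀ k ∈ T,
    P[lam k t | N.history (S ∪ T ∪ C) t] =ᵐ[P] P[lam k t | N.history (T ∪ C) t]

/-- The local-independence graph: for `j ≠ i` there is an edge `j → i` unless `N_i` is locally
independent of `N_j` given all the other components. -/
def localIndependenceGraph (N : PointProcess p Ω) (P : Measure Ω) (lam : Fin p → ℝ≥0 → Ω → ℝ)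
    (𝒯 : Set ℝ≥0) : Digraph (Fin p) where
  Adj j i := j ≠ i ∧ ¬ N.LocallyIndependent P lam 𝒯 {i} {j} ({i} ∪ {j})ᶜ

end PointProcess

/-- The parameters of a temporal point process graphical model: link functions `h`, background
parameters `μ`, transfer matrix `β` and kernels `κ` (so the transfer functions are
`β j k * κ j k`). -/
structure Parameters (p : ℕ) where
  h : Fin p → ℝ → ℝ
  μ : Fin p → ℝ
  β : Matrix (Fin p) (Fin p) ℝ
  κ : Fin p → Fin p → ℝ≥0 → ℝ
  h_nonneg : ∀ j x, 0 ≤ h j x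
  h_continuous : ∀ j, Continuous (h j)
  κ_measurable : ∀ j k, Measurable (κ j k)
  κ_locallyBounded : ∀ j k t, ∃ M : ℝ, ∀ s ≤ t, |κ j k s| ≤ M

namespace Parameters

variable {p : ℕ} {Ω : Type*} [MeasurableSpace Ω]

/-- `h_j (μ_j + ∑_k ∫_{[0, t)} β_{j,k} κ_{j,k}(t - s) dN_k(s))`. -/
def intensity (θ : Parameters p) (N : PointProcess p Ω) (j : Fin p) (t : ℝ≥0) (ω : Ω) : ℝ :=
  θ.h j (θ.μ j + ∑ k, ∫ s in Set.Iio t, θ.β j k * θ.κ j k (t - s) ∂(N.eventMeasure k ω))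

/-- The digraph of the zero pattern of the transfer matrix: an edge `j → i`, `j ≠ i`, if and only
if `β i j ≠ 0`. -/
def transferGraph (θ : Parameters p) : Digraph (Fin p) where
  Adj j i := j ≠ i ∧ θ.β i j ≠ 0

end Parameters

/-- Under `P`, the point process `N` is a temporal point process graphical model with
parameters `θ`. -/
structure IsGraphicalModel {p : ℕ} {Ω : Type*} [MeasurableSpace Ω] (θ : Parameters p)
    (N : PointProcess p Ω) (P : Measure Ω) : Prop where
  noCommonEvents : N.NoCommonEvents P
  isIntensity : ∀ j, N.IsIntensity P j (θ.intensity N j)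

end TPP

end

/-! Given the full history, the conditional expectation of `θ.intensity N i t` is the intensity
itself, so local independence says that this intensity is a.s. equal to a variable `f` that is
measurable for the history without the components in `B`. If the coefficients from `B` vanish, the
intensity formula is already such a variable (`Parameters.stronglyMeasurable_intensity`).

Conversely, let `θ.β i j ≠ 0` and compare two kinds of outcomes: no event at all up to `t`, and a
single event up to `t`, of component `j`, at a time `x` with `θ.κ i j (t - x) ≠ 0`. All counts seen
by `f` are zero in both cases, so `f` takes the same value, while the intensity of `i` moves away
from its background value (`not_ae_eq_of_transfer_ne_zero`). Both events must have positive
probability. As long as nothing new happens the intensities are explicit and bounded, so silence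
persists with positive probability (`measure_inter_quiet_pos`). The law of the first event comes
from testing the intensity identity with the indicator of waiting for it (`measure_inter_firstIn`),
and the positive background intensity of `j` bounds it from below. -/

namespace TPP

/-! ### Lebesgue measure on the half-line -/

section TimeMeasure

theorem timeMeasure_apply (A : Set ℝ≥0) :
    timeMeasure A = volume ((fun t : ℝ≥0 => (t : ℝ)) '' A) :=
  (MeasurableEmbedding.subtype_coe measurableSet_Ici).comap_apply volume A

theorem timeMeasure_Ioc_le (v w : ℝ≥0) : timeMeasure (Set.Ioc v w) ≤ ((w - v : ℝ≥0) : ℝ≥0∞) := by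
  rw [timeMeasure_apply]
  calc volume ((fun t : ℝ≥0 => (t : ℝ)) '' Set.Ioc v w) ≤ volume (Set.Ioc (v : ℝ) w) := by
        refine measure_mono ?_
        rintro _ ⟨s, hs, rfl⟩
        exact ⟨NNReal.coe_lt_coe.2 hs.1, NNReal.coe_le_coe.2 hs.2⟩
    _ = ENNReal.ofReal ((w : ℝ) - v) := Real.volume_Ioc
    _ ≤ ((w - v : ℝ≥0) : ℝ≥0∞) := by
        rw [ENNReal.ofReal]
        refine ENNReal.coe_le_coe.2 ?_
        rw [NNReal.sub_def]

theorem timeMeasure_singleton (t : ℝ≥0) : timeMeasure {t} = 0 := by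
  rw [timeMeasure_apply, Set.image_singleton, Real.volume_singleton]

/-- Reflection preserves null sets on the real line, and dropping the endpoints costs nothing. This
turns a set of lags where a kernel is nonzero into a set of event times. -/
theorem timeMeasure_reflect_pos (t : ℝ≥0) (A : Set ℝ≥0)
    (hA : 0 < timeMeasure {s | s ≤ t ∧ s ∈ A}) :
    0 < timeMeasure {s | 0 < s ∧ s < t ∧ t - s ∈ A} := by
  by_contra! h
  have h0 : timeMeasure {s | 0 < s ∧ s < t ∧ t - s ∈ A} = 0 := le_antisymm h bot_le
  refine hA.ne' ?_
  rw [timeMeasure_apply] at h0 ⊢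
  have h1 := (quasiMeasurePreserving_sub_left (volume : Measure ℝ) (t : ℝ)).preimage_null h0
  refine measure_mono_null ?_ (measure_union_null h1
    ((Set.toFinite {(0 : ℝ), (t : ℝ)}).measure_zero volume))
  rintro _ ⟨s, ⟨hst, hsA⟩, rfl⟩
  rcases eq_or_ne s 0 with rfl | hs0
  · simp
  rcases hst.eq_or_lt with rfl | hlt
  · simp
  · refine Or.inl ⟨t - s, ⟨tsub_pos_of_lt hlt, tsub_lt_self (hs0.bot_lt.trans hlt) hs0.bot_lt, ?_⟩,
      NNReal.coe_sub hst⟩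
    rwa [tsub_tsub_cancel_of_le hst]

end TimeMeasure

/-! ### Measurability with respect to histories -/

namespace PointProcess

variable {p : ℕ} {Ω : Type*} [m : MeasurableSpace Ω] (N : PointProcess p Ω)

theorem countable_times (j : Fin p) (ω : Ω) : (N.times j ω).Countable := by
  have : N.times j ω = ⋃ n : ℕ, N.times j ω ∩ Set.Iic (n : ℝ≥0) := by
    rw [← Set.inter_iUnion]
    refine (Set.inter_eq_left.2 fun s _ => ?_).symm
    obtain ⟨n, hn⟩ := exists_nat_ge s
    exact Set.mem_iUnion.2 ⟨n, hn⟩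
  rw [this]
  exact Set.countable_iUnion fun n => (N.finite_times j ω n).countable

theorem eventMeasure_apply (j : Fin p) (ω : Ω) (A : Set ℝ≥0) :
    N.eventMeasure j ω A = Measure.count (A ∩ N.times j ω) :=
  Measure.restrict_apply' (N.countable_times j ω).measurableSet

theorem eventMeasure_eq_zero_iff (j : Fin p) (ω : Ω) (A : Set ℝ≥0) :
    N.eventMeasure j ω A = 0 ↔ Disjoint (N.times j ω) A := by
  rw [eventMeasure_apply, Measure.count_eq_zero_iff, disjoint_comm, Set.disjoint_iff_inter_eq_empty]

theorem eventMeasure_eq_one_iff (j : Fin p) (ω : Ω) (A : Set ℝ≥0) :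
    N.eventMeasure j ω A = 1 ↔ ∃ x, N.times j ω ∩ A = {x} := by
  rw [eventMeasure_apply, Set.inter_comm, Measure.count_apply
    ((N.countable_times j ω).mono Set.inter_subset_left).measurableSet, ← Set.encard_eq_one]
  norm_cast

theorem eventMeasure_Iic (j : Fin p) (ω : Ω) (t : ℝ≥0) :
    N.eventMeasure j ω (Set.Iic t) = (N.count j t ω : ℝ≥0∞) := by
  rw [eventMeasure_apply, Set.inter_comm, Measure.count_apply_finite _ (N.finite_times j ω t), count,
    Set.ncard_eq_toFinset_card _ (N.finite_times j ω t)]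

theorem measurable_count {S : Set (Fin p)} {j : Fin p} (hj : j ∈ S) {s t : ℝ≥0} (hs : s ≤ t) :
    Measurable[N.history S t] (N.count j s) :=
  measurable_iff_comap_le.2 <| le_iSup₂_of_le j hj <| le_iSup₂_of_le (f := fun r _ =>
    MeasurableSpace.comap (N.count j r) ⊤) s hs le_rfl

/-- The restricted measures are finite, so it suffices to test on the π-system of initial intervals,
where they are counts. They thus form a kernel from the history. -/
theorem measurable_restrict_eventMeasure {S : Set (Fin p)} {j : Fin p} (hj : j ∈ S) (t : ℝ≥0) :
    Measurable[N.history S t] fun ω => (N.eventMeasure j ω).restrict (Set.Iic t) := by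
  have hfin (ω : Ω) : IsFiniteMeasure ((N.eventMeasure j ω).restrict (Set.Iic t)) := by
    refine ⟨?_⟩
    rw [Measure.restrict_apply_univ, eventMeasure_Iic]
    exact ENNReal.natCast_lt_top _
  refine @Measurable.measure_of_isPiSystem _ _ (N.history S t) _ _ hfin _
    (borel_eq_generateFrom_Iic ℝ≥0 ▸ BorelSpace.measurable_eq) isPiSystem_Iic ?_ ?_
  · rintro _ ⟨s, rfl⟩
    simp_rw [Measure.restrict_apply measurableSet_Iic, Set.Iic_inter_Iic, eventMeasure_Iic]
    exact (measurable_from_top (f := fun n : ℕ => (n : ℝ≥0∞))).comp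
      (N.measurable_count hj inf_le_right)
  · simp_rw [Measure.restrict_apply_univ, eventMeasure_Iic]
    exact (measurable_from_top (f := fun n : ℕ => (n : ℝ≥0∞))).comp (N.measurable_count hj le_rfl)

theorem measurable_eventMeasure {S : Set (Fin p)} {j : Fin p} (hj : j ∈ S) {t : ℝ≥0}
    {A : Set ℝ≥0} (hA : MeasurableSet A) (hAt : A ⊆ Set.Iic t) :
    Measurable[N.history S t] fun ω => N.eventMeasure j ω A := by
  have := (Measure.measurable_coe hA).comp (N.measurable_restrict_eventMeasure hj t)
  have e : (fun ω => N.eventMeasure j ω A)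
      = (fun μ : Measure ℝ≥0 => μ A) ∘ fun ω => (N.eventMeasure j ω).restrict (Set.Iic t) := by
    funext ω
    simp [Measure.restrict_apply hA, Set.inter_eq_left.2 hAt]
  rw [e]
  exact this

theorem stronglyMeasurable_setIntegral {S : Set (Fin p)} {j : Fin p} (hj : j ∈ S) (t : ℝ≥0)
    {f : ℝ≥0 → ℝ} (hf : Measurable f) :
    StronglyMeasurable[N.history S t] fun ω => ∫ s in Set.Iio t, f s ∂(N.eventMeasure j ω) := by
  let κ : @ProbabilityTheory.Kernel Ω ℝ≥0 (N.history S t) _ :=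
    @ProbabilityTheory.Kernel.mk _ _ (N.history S t) _ _ (N.measurable_restrict_eventMeasure hj t)
  have h := @StronglyMeasurable.integral_kernel _ _ (N.history S t) _ κ _ _ _
    ((Set.Iio t).indicator f) (hf.indicator measurableSet_Iio).stronglyMeasurable
  have e (ω : Ω) : ∫ s, (Set.Iio t).indicator f s ∂(κ ω)
      = ∫ s in Set.Iio t, f s ∂(N.eventMeasure j ω) := by
    rw [integral_indicator measurableSet_Iio]
    change ∫ s in Set.Iio t, f s ∂((N.eventMeasure j ω).restrict (Set.Iic t)) = _
    rw [Measure.restrict_restrict measurableSet_Iio,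
      Set.inter_eq_left.2 Set.Iio_subset_Iic_self]
  simpa only [e] using h

/-- A set in the history of the components in `S` does not distinguish between outcomes with the same
counts of these components. -/
theorem mem_iff_mem_of_measurableSet_history {S : Set (Fin p)} {t : ℝ≥0} {A : Set Ω}
    (hA : MeasurableSet[N.history S t] A) {ω ω' : Ω}
    (h : ∀ k ∈ S, ∀ s ≤ t, N.count k s ω = N.count k s ω') :
    ω ∈ A ↔ ω' ∈ A := by
  -- The sets that do not separate `ω` from `ω'` form a σ-field; it contains the generators of the
  -- history.
  have hle : N.history S t ≤ MeasurableSpace.mk (fun B : Set Ω => (ω ∈ B ↔ ω' ∈ B)) Iff.rfl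
      (fun B hB => not_congr hB) (fun f hf => by simp only [Set.mem_iUnion, hf]) := by
    refine iSup₂_le fun k hk => iSup₂_le fun s hs => ?_
    rintro _ ⟨B, -, rfl⟩
    change _ ∈ B ↔ _ ∈ B
    rw [h k hk s hs]
  exact hle A hA

theorem eq_of_stronglyMeasurable_history {S : Set (Fin p)} {t : ℝ≥0} {f : Ω → ℝ}
    (hf : StronglyMeasurable[N.history S t] f) {ω ω' : Ω}
    (h : ∀ k ∈ S, ∀ s ≤ t, N.count k s ω = N.count k s ω') : f ω = f ω' :=
  ((N.mem_iff_mem_of_measurableSet_history (hf.measurable (measurableSet_singleton (f ω')))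
    h).2 rfl)

end PointProcess

theorem Parameters.stronglyMeasurable_intensity {p : ℕ} {Ω : Type*} [MeasurableSpace Ω]
    (θ : Parameters p) (N : PointProcess p Ω) {S : Set (Fin p)} {j : Fin p}
    (hS : ∀ k ∉ S, θ.β j k = 0) (t : ℝ≥0) :
    StronglyMeasurable[N.history S t] (θ.intensity N j t) := by
  refine (θ.h_continuous j).comp_stronglyMeasurable (f := fun ω => θ.μ j + ∑ k,
    ∫ s in Set.Iio t, θ.β j k * θ.κ j k (t - s) ∂(N.eventMeasure k ω)) ?_
  refine stronglyMeasurable_const.add (Finset.stronglyMeasurable_fun_sum _ fun k _ => ?_)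
  by_cases hk : k ∈ S
  · exact N.stronglyMeasurable_setIntegral hk t
      (((θ.κ_measurable j k).comp (measurable_const.sub measurable_id)).const_mul _)
  · simpa [hS k hk] using stronglyMeasurable_const

end TPP

namespace TPP

theorem measurable_indicator_one {α : Type*} {mα : MeasurableSpace α} {s : Set α}
    (hs : MeasurableSet s) : Measurable (s.indicator (1 : α → ℝ≥0∞)) :=
  measurable_one.indicator hs

/-! ### Quiet intervals and the law of the first event -/

namespace PointProcess

variable {p : ℕ} {Ω : Type*} [m : MeasurableSpace Ω] (N : PointProcess p Ω)

/-- The event that no component has an event time in `I`. -/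
def quiet (I : Set ℝ≥0) : Set Ω := {ω | ∀ k, Disjoint (N.times k ω) I}

theorem quiet_anti {I J : Set ℝ≥0} (h : I ⊆ J) : N.quiet J ⊆ N.quiet I :=
  fun _ hω k => (hω k).mono_right h

theorem measurableSet_quiet {I : Set ℝ≥0} (hI : MeasurableSet I) {t : ℝ≥0} (ht : I ⊆ Set.Iic t) :
    MeasurableSet[N.history Set.univ t] (N.quiet I) := by
  have e : N.quiet I = ⋂ k, (fun ω => N.eventMeasure k ω I) ⁻¹' {0} := by
    ext ω
    simp [quiet, eventMeasure_eq_zero_iff]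
  rw [e]
  exact @MeasurableSet.iInter _ _ (N.history Set.univ t) _ _ fun k =>
    N.measurable_eventMeasure (Set.mem_univ k) hI ht (measurableSet_singleton 0)

/-- The event that there is exactly one event time in `(u, r]`, that it belongs to component `k`,
and that it lies in `G`. -/
def single (k : Fin p) (u r : ℝ≥0) (G : Set ℝ≥0) : Set Ω :=
  {ω | ∃ x ∈ G, N.times k ω ∩ Set.Ioc u r = {x} ∧ ∀ l ≠ k, Disjoint (N.times l ω) (Set.Ioc u r)}

theorem measurableSet_single (k : Fin p) (u r : ℝ≥0) {G : Set ℝ≥0} (hG : MeasurableSet G) :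
    MeasurableSet[N.history Set.univ r] (N.single k u r G) := by
  -- Unit mass both on the interval and on its part in `G` forces the unique event to lie in `G`.
  have e : N.single k u r G = (fun ω => N.eventMeasure k ω (Set.Ioc u r)) ⁻¹' {1}
      ∩ (fun ω => N.eventMeasure k ω (Set.Ioc u r ∩ G)) ⁻¹' {1}
      ∩ ⋂ l, ⋂ (_ : l ≠ k), (fun ω => N.eventMeasure l ω (Set.Ioc u r)) ⁻¹' {0} := by
    ext ω
    simp only [single, Set.mem_ofPred_eq, Set.mem_inter_iff, Set.mem_preimage,
      Set.mem_singleton_iff, Set.mem_iInter, eventMeasure_eq_zero_iff, eventMeasure_eq_one_iff]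
    constructor
    · rintro ⟨x, hx, h1, h2⟩
      refine ⟨⟨⟨x, h1⟩, x, ?_⟩, h2⟩
      rw [← Set.inter_assoc, h1]
      exact Set.inter_eq_left.2 (Set.singleton_subset_iff.2 hx)
    · rintro ⟨⟨⟨x, h1⟩, y, h3⟩, h2⟩
      rw [← Set.inter_assoc, h1] at h3
      have hy : y ∈ {x} ∩ G := h3 ▸ rfl
      obtain rfl : y = x := hy.1
      exact ⟨y, hy.2, h1, h2⟩
  rw [e]
  refine ((N.measurable_eventMeasure (Set.mem_univ k) measurableSet_Ioc
    Set.Ioc_subset_Iic_self (measurableSet_singleton 1)).inter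
    (N.measurable_eventMeasure (Set.mem_univ k) (measurableSet_Ioc.inter hG)
    (Set.inter_subset_left.trans Set.Ioc_subset_Iic_self) (measurableSet_singleton 1))).inter ?_
  exact @MeasurableSet.iInter _ _ (N.history Set.univ r) _ _ fun l =>
    @MeasurableSet.iInter _ _ (N.history Set.univ r) _ _ fun _ => N.measurable_eventMeasure (Set.mem_univ l) measurableSet_Ioc
    Set.Ioc_subset_Iic_self (measurableSet_singleton 0)

theorem single_subset_single_min (k : Fin p) (u r : ℝ≥0) {t : ℝ≥0} {G : Set ℝ≥0}
    (hG : G ⊆ Set.Iic t) : N.single k u r G ⊆ N.single k u (min r t) G := by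
  rintro ω ⟨x, hx, h1, h2⟩
  have hx' : x ∈ N.times k ω ∩ Set.Ioc u r := h1 ▸ rfl
  have hsub : Set.Ioc u (min r t) ⊆ Set.Ioc u r := Set.Ioc_subset_Ioc_right (min_le_left _ _)
  refine ⟨x, hx, Set.Subset.antisymm ?_ ?_, fun l hl => (h2 l hl).mono_right hsub⟩
  · exact h1 ▸ Set.inter_subset_inter_right _ hsub
  · exact Set.singleton_subset_iff.2 ⟨hx'.1, hx'.2.1, le_min hx'.2.2 (hG hx)⟩

/-- The event that the first event after `u` belongs to component `k` and lies in `G`: it is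
isolated by some time of a countable dense set. -/
def firstIn (k : Fin p) (u : ℝ≥0) (G : Set ℝ≥0) : Set Ω :=
  ⋃ n, N.single k u (TopologicalSpace.denseSeq ℝ≥0 n) G

theorem measurableSet_firstIn (k : Fin p) (u : ℝ≥0) {G : Set ℝ≥0} (hG : MeasurableSet G) :
    MeasurableSet (N.firstIn k u G) :=
  MeasurableSet.iUnion fun _ => N.history_le _ _ _ (N.measurableSet_single k u _ hG)

theorem exists_denseSeq_mem_Ioo {a b : ℝ≥0} (h : a < b) :
    ∃ n, TopologicalSpace.denseSeq ℝ≥0 n ∈ Set.Ioo a b := by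
  obtain ⟨_, ⟨n, rfl⟩, hn⟩ := (TopologicalSpace.denseRange_denseSeq ℝ≥0).exists_between h
  exact ⟨n, hn⟩

theorem mem_firstIn_iff {k : Fin p} {u : ℝ≥0} {G : Set ℝ≥0} {ω : Ω}
    (hω : ∀ j k, j ≠ k → Disjoint (N.times j ω) (N.times k ω)) :
    ω ∈ N.firstIn k u G ↔ ∃ x ∈ N.times k ω, x ∈ G ∧ u < x ∧ ω ∈ N.quiet (Set.Ioo u x) := by
  constructor
  · intro h
    obtain ⟨n, x, hx, h1, h2⟩ := Set.mem_iUnion.1 h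
    have hx' := h1.superset (Set.mem_singleton x)
    refine ⟨x, hx'.1, hx, hx'.2.1, fun l => Set.disjoint_left.2 fun y hy hyx => ?_⟩
    have hyr : y ∈ Set.Ioc u (TopologicalSpace.denseSeq ℝ≥0 n) :=
      ⟨hyx.1, hyx.2.le.trans hx'.2.2⟩
    by_cases hl : l = k
    · subst hl
      exact hyx.2.ne (h1.subset ⟨hy, hyr⟩)
    · exact Set.disjoint_left.1 (h2 l hl) hy hyr
  · rintro ⟨x, hxk, hxG, hux, hq⟩
    -- By local finiteness `x` has a right neighbourhood free of other event times; a dense time in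
    -- it isolates `x`.
    have hfin : ((⋃ l, N.times l ω ∩ Set.Iic (x + 1)) \ {x}).Finite :=
      (Set.finite_iUnion fun l => N.finite_times l ω (x + 1)).sdiff
    obtain ⟨b, hb, hb'⟩ := exists_Ico_subset_of_mem_nhds
      (hfin.isClosed.isOpen_compl.mem_nhds fun h => h.2 rfl) ⟨x + 1, lt_add_one x⟩
    obtain ⟨n, hn1, hn2⟩ := exists_denseSeq_mem_Ioo (lt_min hb (lt_add_one x))
    have key (l : Fin p) (y : ℝ≥0) (hy : y ∈ N.times l ω)
        (hyu : y ∈ Set.Ioc u (TopologicalSpace.denseSeq ℝ≥0 n)) : y = x := by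
      by_contra hne
      rcases lt_or_gt_of_ne hne with h | h
      · exact Set.disjoint_left.1 (hq l) hy ⟨hyu.1, h⟩
      · refine hb' ⟨h.le, hyu.2.trans_lt (hn2.trans_le (min_le_left _ _))⟩ ⟨?_, hne⟩
        exact Set.mem_iUnion.2 ⟨l, hy, hyu.2.trans (hn2.le.trans (min_le_right _ _))⟩
    refine Set.mem_iUnion.2 ⟨n, x, hxG, ?_, fun l hl => ?_⟩
    · refine Set.Subset.antisymm (fun y hy => key k y hy.1 hy.2) ?_
      exact Set.singleton_subset_iff.2 ⟨hxk, hux, hn1.le⟩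
    · refine Set.disjoint_left.2 fun y hy hyu => ?_
      obtain rfl := key l y hy hyu
      exact Set.disjoint_left.1 (hω l k hl) hy hxk

/-- The times `s ∈ G` after `u` such that there is no event in `(u, s)`, on the event `F`. -/
def waiting (F : Set Ω) (u : ℝ≥0) (G : Set ℝ≥0) : Set (ℝ≥0 × Ω) :=
  {q | q.1 ∈ G ∧ u < q.1 ∧ q.2 ∈ F ∧ q.2 ∈ N.quiet (Set.Ioo u q.1)}

theorem measurable_fst_predictable :
    Measurable[N.filtration.predictable] (Prod.fst : ℝ≥0 × Ω → ℝ≥0) := by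
  let := N.filtration.predictable
  refine measurable_of_Ioi fun a => ?_
  have e : (Prod.fst : ℝ≥0 × Ω → ℝ≥0) ⁻¹' Set.Ioi a = Set.Ioi a ×ˢ Set.univ := by
    ext; simp
  rw [e]
  exact measurableSet_predictable_Ioi_prod MeasurableSet.univ

theorem measurableSet_waiting {F : Set Ω} {u : ℝ≥0} (hF : MeasurableSet[N.history Set.univ u] F)
    {G : Set ℝ≥0} (hG : MeasurableSet G) :
    MeasurableSet[N.filtration.predictable] (N.waiting F u G) := by
  -- Silence on the open interval up to `s` is silence up to every dense time `r < s`, and an event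
  -- by time `r` excludes all later `s`. Each excluded set is a predictable rectangle.
  have e : N.waiting F u G = (Prod.fst ⁻¹' G ∩ Set.Ioi u ×ˢ F) \
      ⋃ n, Set.Ioi (TopologicalSpace.denseSeq ℝ≥0 n) ×ˢ
        (N.quiet (Set.Ioc u (TopologicalSpace.denseSeq ℝ≥0 n)))ᶜ := by
    ext ⟨s, ω⟩
    simp only [waiting, Set.mem_ofPred_eq, Set.mem_sdiff, Set.mem_inter_iff, Set.mem_preimage,
      Set.mem_prod, Set.mem_Ioi, Set.mem_iUnion, Set.mem_compl_iff, not_exists, not_and, not_not]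
    constructor
    · rintro ⟨hs, hu, hωF, hq⟩
      exact ⟨⟨hs, hu, hωF⟩, fun n hn => N.quiet_anti (Set.Ioc_subset_Ioo_right hn) hq⟩
    · rintro ⟨⟨hs, hu, hωF⟩, h⟩
      refine ⟨hs, hu, hωF, fun k => Set.disjoint_left.2 fun y hy hys => ?_⟩
      obtain ⟨n, hn⟩ := exists_denseSeq_mem_Ioo hys.2
      exact Set.disjoint_left.1 (h n hn.2 k) hy ⟨hys.1, hn.1.le⟩
  rw [e]
  let := N.filtration.predictable
  refine ((N.measurable_fst_predictable hG).inter
    (measurableSet_predictable_Ioi_prod hF)).diff (MeasurableSet.iUnion fun n => ?_)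
  exact measurableSet_predictable_Ioi_prod
    (N.measurableSet_quiet measurableSet_Ioc Set.Ioc_subset_Iic_self).compl

variable {N} {P : Measure Ω} {lam : ℝ≥0 → Ω → ℝ}

/-- The probability that the first event after `u` belongs to component `k` and lies in `G`. -/
theorem IsIntensity.measure_inter_firstIn {k : Fin p} (h : N.IsIntensity P k lam)
    (hN : N.NoCommonEvents P) {F : Set Ω} {u : ℝ≥0} (hF : MeasurableSet[N.history Set.univ u] F)
    {G : Set ℝ≥0} (hG : MeasurableSet G) :
    P (F ∩ N.firstIn k u G)
      = ∫⁻ ω, ∫⁻ s, (N.waiting F u G).indicator 1 (s, ω) * ENNReal.ofReal (lam s ω)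
          ∂timeMeasure ∂P := by
  have hF' : MeasurableSet F := N.history_le _ _ _ hF
  -- Along the events of `k`, the waiting indicator can only be nonzero at the first event after
  -- `u`, so its integral is the indicator of the event on the left.
  rw [← h.lintegral_eq _ (measurable_indicator_one (N.measurableSet_waiting hF hG)),
    ← lintegral_indicator_one (hF'.inter (N.measurableSet_firstIn k u hG))]
  refine lintegral_congr_ae ?_
  filter_upwards [hN] with ω hω
  have hT := (N.countable_times k ω).measurableSet
  by_cases hmem : ω ∈ F ∩ N.firstIn k u G
  · obtain ⟨x, hxk, hxG, hux, hq⟩ := (N.mem_firstIn_iff hω).1 hmem.2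
    have e : Set.EqOn (fun s => (N.waiting F u G).indicator (1 : ℝ≥0 × Ω → ℝ≥0∞) (s, ω))
        (({x} : Set ℝ≥0).indicator 1) (N.times k ω) := by
      intro s hs
      by_cases hsx : s = x
      · subst hsx
        have : (s, ω) ∈ N.waiting F u G := ⟨hxG, hux, hmem.1, hq⟩
        simp [this]
      · have : (s, ω) ∉ N.waiting F u G := by
          rintro ⟨-, hus, -, hqs⟩
          rcases lt_or_gt_of_ne hsx with h1 | h1
          · exact Set.disjoint_left.1 (hq k) hs ⟨hus, h1⟩
          · exact Set.disjoint_left.1 (hqs k) hxk ⟨hux, h1⟩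
        simp [this, hsx]
    rw [Set.indicator_of_mem hmem, eventMeasure, setLIntegral_congr_fun hT e,
      lintegral_indicator_one (measurableSet_singleton x), Measure.restrict_apply' hT,
      Set.inter_eq_left.2 (Set.singleton_subset_iff.2 hxk), Measure.count_singleton, Pi.one_apply]
  · have e : Set.EqOn (fun s => (N.waiting F u G).indicator (1 : ℝ≥0 × Ω → ℝ≥0∞) (s, ω))
        0 (N.times k ω) := by
      intro s hs
      refine Set.indicator_of_notMem ?_ _
      rintro ⟨hsG, hus, hωF, hqs⟩
      exact hmem ⟨hωF, (N.mem_firstIn_iff hω).2 ⟨s, hs, hsG, hus, hqs⟩⟩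
    rw [Set.indicator_of_notMem hmem, eventMeasure, setLIntegral_congr_fun hT e]
    simp

/-- Almost surely there is no event at time zero. -/
theorem measure_quiet_zero [IsProbabilityMeasure P] {lam : Fin p → ℝ≥0 → Ω → ℝ}
    (h : ∀ k, N.IsIntensity P k (lam k)) : P (N.quiet {0}) = 1 := by
  -- The time slice at zero is predictable and Lebesgue-null, so the intensity identity gives
  -- expected count zero there.
  have hm : MeasurableSet[N.filtration.predictable] (({0} : Set ℝ≥0) ×ˢ (Set.univ : Set Ω)) :=
    measurableSet_predictable_singleton_bot_prod MeasurableSet.univ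
  have h0 (k : Fin p) : ∀ᵐ ω ∂P, N.eventMeasure k ω {0} = 0 := by
    have h1 := (h k).lintegral_eq _ (measurable_indicator_one hm)
    have hz (ω : Ω) : ∫⁻ s, (({0} : Set ℝ≥0) ×ˢ (Set.univ : Set Ω)).indicator
        (1 : ℝ≥0 × Ω → ℝ≥0∞) (s, ω) * ENNReal.ofReal (lam k s ω) ∂timeMeasure = 0 := by
      refine lintegral_eq_zero_of_ae_eq_zero ?_
      filter_upwards [compl_mem_ae_iff.2 (timeMeasure_singleton 0)] with s hs
      have : (s, ω) ∉ ({0} : Set ℝ≥0) ×ˢ (Set.univ : Set Ω) := fun h => hs h.1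
      simp [Set.indicator_of_notMem this]
    have he (ω : Ω) : ∫⁻ s, (({0} : Set ℝ≥0) ×ˢ (Set.univ : Set Ω)).indicator
        (1 : ℝ≥0 × Ω → ℝ≥0∞) (s, ω) ∂(N.eventMeasure k ω) = N.eventMeasure k ω {0} := by
      rw [← lintegral_indicator_one (measurableSet_singleton 0)]
      refine lintegral_congr fun s => ?_
      by_cases hs : s = 0 <;> simp [hs, Set.indicator]
    simp_rw [hz, he, lintegral_zero] at h1
    refine (lintegral_eq_zero_iff (N.history_le Set.univ 0 |> fun hle =>
      (N.measurable_eventMeasure (Set.mem_univ k) (measurableSet_singleton 0)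
        (Set.singleton_subset_iff.2 (le_refl (0 : ℝ≥0)))).mono hle le_rfl)).1 h1
  have hq : N.quiet {0} ∈ ae P := by
    filter_upwards [ae_all_iff.2 h0] with ω hω
    exact fun k => (N.eventMeasure_eq_zero_iff k ω _).1 (hω k)
  rw [← measure_univ (μ := P)]
  exact measure_congr (Filter.eventuallyEq_univ.2 hq)

end PointProcess

end TPP

namespace TPP

/-! ### Silence persists with positive probability -/

namespace PointProcess

variable {p : ℕ} {Ω : Type*} [m : MeasurableSpace Ω] {N : PointProcess p Ω} {P : Measure Ω}
  {lam : Fin p → ℝ≥0 → Ω → ℝ}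

/-- If silence up to `v` is broken by `w`, local finiteness provides an earliest event, which must
come after `v`. -/
theorem mem_quiet_union_firstIn {u v w : ℝ≥0} {ω : Ω}
    (hω : ∀ j k, j ≠ k → Disjoint (N.times j ω) (N.times k ω))
    (hv : ω ∈ N.quiet (Set.Ioc u v)) :
    ω ∈ N.quiet (Set.Ioc u w) ∪ ⋃ k, N.firstIn k u (Set.Ioc v w) := by
  by_cases hw : ω ∈ N.quiet (Set.Ioc u w)
  · exact Or.inl hw
  refine Or.inr ?_
  have hfin : (⋃ l, N.times l ω ∩ Set.Ioc u w).Finite := Set.finite_iUnion fun l =>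
    (N.finite_times l ω w).subset (Set.inter_subset_inter_right _ Set.Ioc_subset_Iic_self)
  have hne : (⋃ l, N.times l ω ∩ Set.Ioc u w).Nonempty := by
    by_contra hempty
    refine hw fun k => Set.disjoint_left.2 fun y hy hyw => hempty ⟨y, Set.mem_iUnion.2 ⟨k, hy, hyw⟩⟩
  obtain ⟨x, hx, hmin⟩ := Set.exists_min_image _ id hfin hne
  obtain ⟨k, hxk, hxw⟩ := Set.mem_iUnion.1 hx
  have hvx : v < x := by
    by_contra! h
    exact Set.disjoint_left.1 (hv k) hxk ⟨hxw.1, h⟩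
  refine Set.mem_iUnion.2 ⟨k, (N.mem_firstIn_iff hω).2 ⟨x, hxk, ⟨hvx, hxw.2⟩, hxw.1, fun l =>
    Set.disjoint_left.2 fun y hy hyx => ?_⟩⟩
  exact (hmin y (Set.mem_iUnion.2 ⟨l, hy, hyx.1, hyx.2.le.trans hxw.2⟩)).not_gt hyx.2

/-- If the intensities are bounded on the event `F` until the first event after `u`, then the
probability that this event occurs during a further time interval is controlled by its length. -/
theorem measure_inter_quiet_le (h : ∀ k, N.IsIntensity P k (lam k)) (hN : N.NoCommonEvents P)
    {F : Set Ω} {u v w : ℝ≥0} (hF : MeasurableSet[N.history Set.univ u] F)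
    (M : Fin p → ℝ≥0)
    (hM : ∀ k, ∀ s ∈ Set.Ioc u w, ∀ ω ∈ F ∩ N.quiet (Set.Ioo u s), lam k s ω ≤ M k) :
    P (F ∩ N.quiet (Set.Ioc u v)) ≤ P (F ∩ N.quiet (Set.Ioc u w))
      + ((∑ k, M k) * (w - v) : ℝ≥0) * P (F ∩ N.quiet (Set.Ioc u v)) := by
  have hmeas : MeasurableSet (F ∩ N.quiet (Set.Ioc u v)) := (N.history_le _ _ _ hF).inter
    (N.history_le _ _ _ (N.measurableSet_quiet measurableSet_Ioc Set.Ioc_subset_Iic_self))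
  have hk (k : Fin p) : P (F ∩ N.firstIn k u (Set.Ioc v w))
      ≤ (M k * (w - v) : ℝ≥0) * P (F ∩ N.quiet (Set.Ioc u v)) := by
    rw [(h k).measure_inter_firstIn hN hF measurableSet_Ioc]
    calc _ ≤ ∫⁻ ω, (M k * (w - v) : ℝ≥0) * (F ∩ N.quiet (Set.Ioc u v)).indicator 1 ω ∂P := by
          refine lintegral_mono fun ω => ?_
          calc _ ≤ ∫⁻ s, (Set.Ioc v w).indicator (fun _ => (M k : ℝ≥0∞) *
                (F ∩ N.quiet (Set.Ioc u v)).indicator 1 ω) s ∂timeMeasure := by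
                refine lintegral_mono fun s => ?_
                by_cases hs : (s, ω) ∈ N.waiting F u (Set.Ioc v w)
                · obtain ⟨hsv, hus, hωF, hq⟩ := hs
                  have hmem : ω ∈ F ∩ N.quiet (Set.Ioc u v) :=
                    ⟨hωF, N.quiet_anti (Set.Ioc_subset_Ioo_right hsv.1) hq⟩
                  rw [Set.indicator_of_mem (show (s, ω) ∈ N.waiting F u (Set.Ioc v w) from
                    ⟨hsv, hus, hωF, hq⟩), Set.indicator_of_mem hsv, Set.indicator_of_mem hmem,
                    Pi.one_apply, Pi.one_apply, one_mul, mul_one, ← ENNReal.ofReal_coe_nnreal]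
                  exact ENNReal.ofReal_le_ofReal (hM k s ⟨hus, hsv.2⟩ ω ⟨hωF, hq⟩)
                · rw [Set.indicator_of_notMem hs, zero_mul]
                  exact bot_le
            _ = (M k : ℝ≥0∞) * (F ∩ N.quiet (Set.Ioc u v)).indicator 1 ω
                * timeMeasure (Set.Ioc v w) := lintegral_indicator_const measurableSet_Ioc _
            _ ≤ (M k : ℝ≥0∞) * (F ∩ N.quiet (Set.Ioc u v)).indicator 1 ω
                * ((w - v : ℝ≥0) : ℝ≥0∞) := by gcongr; exact timeMeasure_Ioc_le v w
            _ = _ := by rw [ENNReal.coe_mul]; ring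
      _ = _ := by
          rw [lintegral_const_mul _ (measurable_indicator_one hmeas),
            lintegral_indicator_one hmeas]
  calc P (F ∩ N.quiet (Set.Ioc u v))
      ≤ P ((F ∩ N.quiet (Set.Ioc u w)) ∪ ⋃ k, (F ∩ N.firstIn k u (Set.Ioc v w))) := by
        refine measure_mono_ae ?_
        filter_upwards [hN] with ω hω
        rintro ⟨hωF, hv⟩
        rcases mem_quiet_union_firstIn (w := w) hω hv with hw | hw
        · exact Or.inl ⟨hωF, hw⟩
        · obtain ⟨k, hk⟩ := Set.mem_iUnion.1 hw
          exact Or.inr (Set.mem_iUnion.2 ⟨k, hωF, hk⟩)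
    _ ≤ P (F ∩ N.quiet (Set.Ioc u w)) + ∑ k, P (F ∩ N.firstIn k u (Set.Ioc v w)) :=
        (measure_union_le _ _).trans (by gcongr; exact measure_iUnion_fintype_le _ _)
    _ ≤ P (F ∩ N.quiet (Set.Ioc u w))
          + ∑ k, ((M k * (w - v) : ℝ≥0) : ℝ≥0∞) * P (F ∩ N.quiet (Set.Ioc u v)) := by
        gcongr with k
        exact hk k
    _ = _ := by rw [← Finset.sum_mul, ← ENNReal.ofNNReal_finsetSum, Finset.sum_mul]

/-- If the intensities are bounded on the event `F` until the first event after `u`, then with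
positive probability there is no such event up to time `t`. -/
theorem measure_inter_quiet_pos [IsFiniteMeasure P] (h : ∀ k, N.IsIntensity P k (lam k))
    (hN : N.NoCommonEvents P) {F : Set Ω} {u t : ℝ≥0}
    (hF : MeasurableSet[N.history Set.univ u] F) (hut : u ≤ t) (M : Fin p → ℝ≥0)
    (hM : ∀ k, ∀ s ∈ Set.Ioc u t, ∀ ω ∈ F ∩ N.quiet (Set.Ioo u s), lam k s ω ≤ M k)
    (hpos : 0 < P F) : 0 < P (F ∩ N.quiet (Set.Ioc u t)) := by
  -- Over a step of length `δ` only a fraction less than one of the mass is lost, so finitely many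
  -- steps reach `t` with mass left.
  obtain ⟨δ, hδ, hδ'⟩ : ∃ δ : ℝ≥0, 0 < δ ∧ (∑ k, M k) * δ < 1 := by
    refine ⟨((∑ k, M k) + 1)⁻¹, by positivity, ?_⟩
    rw [← div_eq_mul_inv, div_lt_one (by positivity)]
    exact lt_add_one _
  have main (n : ℕ) : ∀ v, u ≤ v → v ≤ t → v ≤ u + n * δ →
      0 < P (F ∩ N.quiet (Set.Ioc u v)) := by
    induction n with
    | zero =>
      intro v huv _ hv
      obtain rfl : v = u := le_antisymm (by simpa using hv) huv
      have : N.quiet (Set.Ioc v v) = Set.univ := by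
        ext; simp [quiet]
      rwa [this, Set.inter_univ]
    | succ n ih =>
      intro w huw hwt hw
      rcases le_total w (u + n * δ) with hle | hle
      · exact ih w huw hwt hle
      have hq := ih (u + n * δ) le_self_add (hle.trans hwt) le_rfl
      have hstep := measure_inter_quiet_le (v := u + n * δ) (w := w) h hN hF M
        fun k s hs => hM k s ⟨hs.1, hs.2.trans hwt⟩
      by_contra! h0
      rw [le_antisymm h0 bot_le, zero_add] at hstep
      refine hstep.not_gt ?_
      calc _ < 1 * P (F ∩ N.quiet (Set.Ioc u (u + n * δ))) := by
            refine ENNReal.mul_lt_mul_left hq.ne' (measure_ne_top _ _) ?_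
            rw [← ENNReal.coe_one, ENNReal.coe_lt_coe]
            refine lt_of_le_of_lt ?_ hδ'
            gcongr
            rw [tsub_le_iff_left]
            refine hw.trans_eq ?_
            push_cast
            ring
        _ = _ := one_mul _
  obtain ⟨n, hn⟩ := exists_nat_ge (t / δ)
  refine main n t hut le_rfl ?_
  exact ((div_le_iff₀ hδ).1 hn).trans le_add_self

end PointProcess

/-! ### Intensities along paths with at most one event -/

namespace Parameters

variable {p : ℕ} {Ω : Type*} [MeasurableSpace Ω] (θ : Parameters p) (N : PointProcess p Ω)

theorem setIntegral_eventMeasure (j : Fin p) (ω : Ω) (s : ℝ≥0) (f : ℝ≥0 → ℝ) :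
    ∫ x in Set.Iio s, f x ∂(N.eventMeasure j ω)
      = ∫ x in N.times j ω ∩ Set.Iio s, f x ∂Measure.count := by
  rw [PointProcess.eventMeasure, Measure.restrict_restrict measurableSet_Iio, Set.inter_comm]

theorem intensity_of_quiet {s : ℝ≥0} {ω : Ω} (h : ω ∈ N.quiet (Set.Iio s)) (i : Fin p) :
    θ.intensity N i s ω = θ.h i (θ.μ i) := by
  rw [intensity, Finset.sum_eq_zero, add_zero]
  intro k _
  rw [setIntegral_eventMeasure, (h k).inter_eq, setIntegral_empty]

theorem intensity_of_single {s x : ℝ≥0} {ω : Ω} {j : Fin p} (hx : N.times j ω ∩ Set.Iio s = {x})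
    (h : ∀ l ≠ j, Disjoint (N.times l ω) (Set.Iio s)) (i : Fin p) :
    θ.intensity N i s ω = θ.h i (θ.μ i + θ.β i j * θ.κ i j (s - x)) := by
  rw [intensity, Finset.sum_eq_single j]
  · rw [setIntegral_eventMeasure, hx, Measure.restrict_singleton, Measure.count_singleton, one_smul,
      integral_dirac]
  · intro k _ hk
    rw [setIntegral_eventMeasure, (h k hk).inter_eq, setIntegral_empty]
  · simp

/-- The kernel is locally bounded, so the link function is only evaluated on a compact set. This
bounds the intensities after a single event without assuming bounded link functions. -/
theorem exists_bound (t : ℝ≥0) (i j : Fin p) :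
    ∃ M : ℝ≥0, ∀ s ≤ t, θ.h i (θ.μ i + θ.β i j * θ.κ i j s) ≤ M := by
  obtain ⟨K, hK⟩ := θ.κ_locallyBounded i j t
  obtain ⟨M, hM⟩ := (isCompact_closedBall (θ.μ i) (|θ.β i j| * K)).bddAbove_image
    (θ.h_continuous i).continuousOn
  refine ⟨M.toNNReal, fun s hs => (hM ⟨_, ?_, rfl⟩).trans (Real.le_coe_toNNReal M)⟩
  rw [Metric.mem_closedBall, Real.dist_eq, add_sub_cancel_left, abs_mul]
  exact mul_le_mul_of_nonneg_left (hK s hs) (abs_nonneg _)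

end Parameters

end TPP

/-! ### Positive probability of the two outcomes, and the equivalence -/

namespace TPP

theorem exists_mem_of_measure_pos_of_ae {α : Type*} {mα : MeasurableSpace α} {μ : Measure α}
    {s : Set α} (hs : 0 < μ s) {q : α → Prop} (hq : ∀ᵐ a ∂μ, q a) : ∃ a ∈ s, q a := by
  by_contra! h
  exact hs.ne' (measure_mono_null h hq)

/-- Glues three pieces of information, at time zero, on `(0, u]` and on `I`, into a description of
all events in `J`. -/
theorem PointProcess.exists_of_mem_single {p : ℕ} {Ω : Type*} [MeasurableSpace Ω]
    {N : PointProcess p Ω} {j : Fin p} {u : ℝ≥0} {G I J : Set ℝ≥0} {ω : Ω}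
    (h0 : ω ∈ N.quiet {0}) (h : ω ∈ N.single j 0 u G) (hI : ω ∈ N.quiet I)
    (hJ : J ⊆ Set.Iic u ∪ I) (hG : G ∩ Set.Iic u ⊆ J) :
    ∃ x ∈ G, x ≤ u ∧ N.times j ω ∩ J = {x} ∧ ∀ l ≠ j, Disjoint (N.times l ω) J := by
  obtain ⟨x, hxG, h1, h2⟩ := h
  have hx := h1.superset (Set.mem_singleton x)
  have key (l : Fin p) {y : ℝ≥0} (hy : y ∈ N.times l ω) (hyJ : y ∈ J) : y ∈ Set.Ioc 0 u := by
    refine ⟨pos_iff_ne_zero.2 fun hy0 => Set.disjoint_left.1 (h0 l) hy hy0, ?_⟩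
    exact (hJ hyJ).resolve_right fun hyI => Set.disjoint_left.1 (hI l) hy hyI
  refine ⟨x, hxG, hx.2.2, Set.Subset.antisymm ?_ ?_, fun l hl => ?_⟩
  · exact fun y hy => h1.subset ⟨hy.1, key j hy.1 hy.2⟩
  · exact Set.singleton_subset_iff.2 ⟨hx.1, hG ⟨hxG, hx.2.2⟩⟩
  · exact Set.disjoint_left.2 fun y hy hyJ => Set.disjoint_left.1 (h2 l hl) hy (key l hy hyJ)

theorem PointProcess.count_eq_zero {p : ℕ} {Ω : Type*} [MeasurableSpace Ω]
    {N : PointProcess p Ω} {k : Fin p} {s t : ℝ≥0} {ω : Ω}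
    (h : Disjoint (N.times k ω) (Set.Iic t)) (hs : s ≤ t) : N.count k s ω = 0 := by
  rw [PointProcess.count, (h.mono_right (Set.Iic_subset_Iic.2 hs)).inter_eq, Set.ncard_empty]

namespace IsGraphicalModel

variable {p : ℕ} {Ω : Type*} [MeasurableSpace Ω] {P : Measure Ω} [IsProbabilityMeasure P]
  {θ : Parameters p} {N : PointProcess p Ω}

/-- Before any event each intensity equals its constant background value, which serves as the bound.
Time zero is treated apart because the persistence estimate concerns `(0, t]`. -/
theorem measure_quiet_pos (hN : IsGraphicalModel θ N P) (t : ℝ≥0) :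
    0 < P (N.quiet (Set.Iic t)) := by
  refine (PointProcess.measure_inter_quiet_pos (t := t) hN.isIntensity hN.noCommonEvents
    (N.measurableSet_quiet (measurableSet_singleton 0)
    (Set.singleton_subset_iff.2 (le_refl (0 : ℝ≥0)))) zero_le
    (fun k => (θ.h k (θ.μ k)).toNNReal) ?_ ?_).trans_le (measure_mono ?_)
  · intro k s hs ω hω
    have hq : ω ∈ N.quiet (Set.Iio s) := fun l =>
      (Set.disjoint_union_right.2 ⟨hω.1 l, hω.2 l⟩).mono_right fun y hy => by
        rcases eq_or_ne y 0 with h | h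
        · exact Or.inl h
        · exact Or.inr ⟨pos_iff_ne_zero.2 h, hy⟩
    rw [θ.intensity_of_quiet N hq]
    exact Real.le_coe_toNNReal _
  · rw [PointProcess.measure_quiet_zero hN.isIntensity]
    exact one_pos
  · refine fun ω hω k => (Set.disjoint_union_right.2 ⟨hω.1 k, hω.2 k⟩).mono_right fun y hy => ?_
    rcases eq_or_ne y 0 with h | h
    · exact Or.inl h
    · exact Or.inr ⟨pos_iff_ne_zero.2 h, hy⟩

/-- On outcomes silent up to `t` one is waiting throughout `G` at the background rate, so the
probability is at least that rate times the length of `G` times the probability of silence. -/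
theorem measure_firstIn_pos (hN : IsGraphicalModel θ N P) {j : Fin p} (hj : 0 < θ.h j (θ.μ j))
    {t : ℝ≥0} {G : Set ℝ≥0} (hG : MeasurableSet G) (hGt : G ⊆ Set.Ioo 0 t)
    (hpos : 0 < timeMeasure G) : 0 < P (N.quiet {0} ∩ N.firstIn j 0 G) := by
  have hF := N.measurableSet_quiet (measurableSet_singleton 0)
    (Set.singleton_subset_iff.2 (le_refl (0 : ℝ≥0)))
  have hQ : MeasurableSet (N.quiet (Set.Iic t)) :=
    N.history_le _ _ _ (N.measurableSet_quiet measurableSet_Iic subset_rfl)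
  rw [(hN.isIntensity j).measure_inter_firstIn hN.noCommonEvents hF hG]
  have h0 : 0 < ENNReal.ofReal (θ.h j (θ.μ j)) * timeMeasure G * P (N.quiet (Set.Iic t)) :=
    ENNReal.mul_pos (mul_ne_zero (ENNReal.ofReal_pos.2 hj).ne' hpos.ne')
      (hN.measure_quiet_pos t).ne'
  refine h0.trans_le ?_
  rw [← lintegral_indicator_const hQ]
  refine lintegral_mono fun ω => ?_
  by_cases hω : ω ∈ N.quiet (Set.Iic t)
  · rw [Set.indicator_of_mem hω, ← lintegral_indicator_const hG]
    refine lintegral_mono fun s => ?_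
    by_cases hs : s ∈ G
    · have hst := hGt hs
      have hmem : (s, ω) ∈ N.waiting (N.quiet {0}) 0 G :=
        ⟨hs, hst.1, N.quiet_anti (Set.singleton_subset_iff.2 (Set.mem_Iic.2 zero_le)) hω,
          N.quiet_anti (fun y hy => (hy.2.trans hst.2).le) hω⟩
      rw [Set.indicator_of_mem hs, Set.indicator_of_mem hmem, Pi.one_apply, one_mul,
        θ.intensity_of_quiet N (N.quiet_anti (fun y hy => (lt_trans hy hst.2).le) hω)]
    · rw [Set.indicator_of_notMem hs]
      exact bot_le
  · rw [Set.indicator_of_notMem hω]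
    exact bot_le

theorem exists_measure_single_pos (hN : IsGraphicalModel θ N P) {j : Fin p}
    (hj : 0 < θ.h j (θ.μ j)) {t : ℝ≥0} {G : Set ℝ≥0} (hG : MeasurableSet G)
    (hGt : G ⊆ Set.Ioo 0 t) (hpos : 0 < timeMeasure G) :
    ∃ u ≤ t, 0 < P (N.quiet {0} ∩ N.single j 0 u G ∩ N.quiet (Set.Ioc u t)) := by
  obtain ⟨n, hn⟩ : ∃ n, 0 < P (N.quiet {0} ∩
      N.single j 0 (TopologicalSpace.denseSeq ℝ≥0 n) G) := by
    by_contra! h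
    refine (hN.measure_firstIn_pos hj hG hGt hpos).ne' ?_
    rw [PointProcess.firstIn, Set.inter_iUnion]
    exact measure_iUnion_null fun n => le_antisymm (h n) bot_le
  -- The isolating time may exceed `t`; truncation is harmless since `G` lies before `t`.
  refine ⟨min (TopologicalSpace.denseSeq ℝ≥0 n) t, min_le_right _ _, ?_⟩
  set u := min (TopologicalSpace.denseSeq ℝ≥0 n) t
  have hpos' : 0 < P (N.quiet {0} ∩ N.single j 0 u G) :=
    hn.trans_le (measure_mono (Set.inter_subset_inter_right _
      (N.single_subset_single_min j 0 _ fun y hy => (hGt hy).2.le)))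
  choose M hM using fun k => θ.exists_bound t k j
  refine PointProcess.measure_inter_quiet_pos hN.isIntensity hN.noCommonEvents ?_
    (min_le_right _ _) M ?_ hpos'
  · refine MeasurableSet.inter ?_ (N.measurableSet_single j 0 u hG)
    exact N.measurableSet_quiet (measurableSet_singleton 0)
      (Set.singleton_subset_iff.2 (Set.mem_Iic.2 zero_le))
  · rintro k s hs ω ⟨⟨h0, h1⟩, h2⟩
    obtain ⟨x, -, -, hx, hl⟩ := PointProcess.exists_of_mem_single (J := Set.Iio s) h0 h1 h2
      (fun y hy => (le_or_gt y u).imp id fun h => ⟨h, hy⟩) fun y hy => lt_of_le_of_lt hy.2 hs.1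
    rw [θ.intensity_of_single N hx hl]
    exact hM k _ (tsub_le_self.trans hs.2)

/-- If component `j` has a nonzero transfer coefficient to component `i`, then the intensity of `i`
is not almost surely determined by the history of components other than `j`. -/
theorem not_ae_eq_of_transfer_ne_zero (hN : IsGraphicalModel θ N P) {i j : Fin p}
    (hj : 0 < θ.h j (θ.μ j)) (hlink : ∀ x, x ≠ θ.μ i → θ.h i x ≠ θ.h i (θ.μ i)) {t : ℝ≥0}
    (hker : 0 < timeMeasure {s : ℝ≥0 | s ≤ t ∧ θ.κ i j s ≠ 0}) (hβ : θ.β i j ≠ 0)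
    {S : Set (Fin p)} (hS : j ∉ S) {f : Ω → ℝ} (hf : StronglyMeasurable[N.history S t] f) :
    ¬ θ.intensity N i t =ᵐ[P] f := by
  intro hae
  set G : Set ℝ≥0 := {s | 0 < s ∧ s < t ∧ t - s ∈ {r | θ.κ i j r ≠ 0}} with hGdef
  have hGpos : 0 < timeMeasure G := timeMeasure_reflect_pos t {r | θ.κ i j r ≠ 0} hker
  have hGt : G ⊆ Set.Ioo 0 t := fun s hs => ⟨hs.1, hs.2.1⟩
  have hG : MeasurableSet G := measurableSet_Ioi.inter (measurableSet_Iio.inter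
    ((measurable_const.sub measurable_id)
      ((θ.κ_measurable i j) (measurableSet_singleton 0).compl)))
  obtain ⟨ω, hω, hωf⟩ := exists_mem_of_measure_pos_of_ae (hN.measure_quiet_pos t) hae
  obtain ⟨u, hut, hu⟩ := hN.exists_measure_single_pos hj hG hGt hGpos
  obtain ⟨ω', ⟨⟨h0, h1⟩, h2⟩, hωf'⟩ := exists_mem_of_measure_pos_of_ae hu hae
  have hcover : Set.Iic t ⊆ Set.Iic u ∪ Set.Ioc u t :=
    fun y hy => (le_or_gt y u).imp id fun h => ⟨h, hy⟩
  -- The intensity sees events strictly before `t`, the history also those at `t`; hence both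
  -- `Set.Iio t` and `Set.Iic t` are needed.
  obtain ⟨x, hxG, -, hx, hl⟩ := PointProcess.exists_of_mem_single (J := Set.Iio t) h0 h1 h2
    (Set.Iio_subset_Iic_self.trans hcover) fun y hy => (hGt hy.1).2
  obtain ⟨-, -, -, -, hl'⟩ := PointProcess.exists_of_mem_single (J := Set.Iic t) h0 h1 h2
    hcover fun y hy => (hGt hy.1).2.le
  have hff : f ω = f ω' := N.eq_of_stronglyMeasurable_history hf fun k hk s hs => by
    rw [PointProcess.count_eq_zero (hω k) hs,
      PointProcess.count_eq_zero (hl' k fun h => hS (h ▸ hk)) hs]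
  rw [← hωf, ← hωf', θ.intensity_of_quiet N (N.quiet_anti Set.Iio_subset_Iic_self hω),
    θ.intensity_of_single N hx hl] at hff
  refine hlink _ ?_ hff.symm
  rw [Ne, add_eq_left]
  exact mul_ne_zero hβ hxG.2.2

theorem locallyIndependent_iff (hN : IsGraphicalModel θ N P) {𝒯 : Set ℝ≥0}
    (hint : ∀ j, ∀ t ∈ 𝒯, Integrable (θ.intensity N j t) P)
    (hpos : ∀ j, 0 < θ.h j (θ.μ j))
    (hlink : ∀ j x, x ≠ θ.μ j → θ.h j x ≠ θ.h j (θ.μ j))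
    (hker : ∀ i j, i ≠ j → ∃ t ∈ 𝒯, 0 < timeMeasure {s : ℝ≥0 | s ≤ t ∧ θ.κ i j s ≠ 0})
    {A B : Set (Fin p)} (hAB : Disjoint A B) :
    N.LocallyIndependent P (θ.intensity N) 𝒯 A B (A ∪ B)ᶜ ↔ ∀ i ∈ A, ∀ j ∈ B, θ.β i j = 0 := by
  have hall (k : Fin p) : k ∈ B ∪ A ∪ (A ∪ B)ᶜ := by
    rw [Set.union_comm B A, Set.union_compl_self]
    exact Set.mem_univ k
  have hfull (k : Fin p) {t : ℝ≥0} (ht : t ∈ 𝒯) :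
      P[θ.intensity N k t | N.history (B ∪ A ∪ (A ∪ B)ᶜ) t] = θ.intensity N k t :=
    condExp_of_stronglyMeasurable (N.history_le _ t)
      (θ.stronglyMeasurable_intensity N (fun l hl => absurd (hall l) hl) t) (hint k t ht)
  constructor
  · intro h i hi j hj
    by_contra hβ
    obtain ⟨t, ht, hκ⟩ := hker i j fun hij => Set.disjoint_left.1 hAB hi (hij ▸ hj)
    have hae := h t ht i hi
    rw [hfull i ht] at hae
    refine hN.not_ae_eq_of_transfer_ne_zero (hpos j) (hlink i) hκ hβ ?_
      stronglyMeasurable_condExp hae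
    rintro (h | h)
    -- The smaller history involves `A` and the complement of `A ∪ B`; neither contains `j`.
    · exact Set.disjoint_left.1 hAB h hj
    · exact h (Or.inr hj)
  · intro h t ht k hk
    rw [hfull k ht, condExp_of_stronglyMeasurable (N.history_le _ t)
      (θ.stronglyMeasurable_intensity N (fun l hl => h k hk l ?_) t) (hint k t ht)]
    by_contra hlB
    exact hl ((em (l ∈ A)).imp id fun hlA h => h.elim hlA hlB)

end IsGraphicalModel

end TPP

theorem proposition1 {p : ℕ} {Ω : Type*} [MeasurableSpace Ω] (P : Measure Ω)
    [IsProbabilityMeasure P] (θ : TPP.Parameters p) (N : TPP.PointProcess p Ω)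
    (hN : TPP.IsGraphicalModel θ N P) (𝒯 : Set ℝ≥0)
    (hint : ∀ j, ∀ t ∈ 𝒯, Integrable (θ.intensity N j t) P)
    (hpos : ∀ j, 0 < θ.h j (θ.μ j))
    (hlink : ∀ j x, x ≠ θ.μ j → θ.h j x ≠ θ.h j (θ.μ j))
    (hker : ∀ i j, i ≠ j →
      ∃ t ∈ 𝒯, 0 < TPP.timeMeasure {s : ℝ≥0 | s ≤ t ∧ θ.κ i j s ≠ 0}) :
    (∀ A B : Set (Fin p), Disjoint A B →
      (N.LocallyIndependent P (θ.intensity N) 𝒯 A B (A ∪ B)ᶜ ↔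
        ∀ i ∈ A, ∀ j ∈ B, θ.β i j = 0)) ∧
    N.localIndependenceGraph P (θ.intensity N) 𝒯 = θ.transferGraph := by
  have main (A B : Set (Fin p)) (hAB : Disjoint A B) :=
    hN.locallyIndependent_iff hint hpos hlink hker hAB
  refine ⟨main, ?_⟩
  ext j i
  refine and_congr_right fun hji => not_congr ?_
  rw [main {i} {j} (Set.disjoint_singleton.2 hji.symm)]
  simp
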